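/- A quotient Borel space is a pair $(X,E)$, where $X$ is a standard Borel space and $E$ is a countable Borel equivalence relation on $X$ (that is, $E$ is Borel in $X\times X$ and all its classes are countable); its underlying set is $X/E$. A subset $A\subseteq X/E$ is called Borel (respectively $\Sigma^1_1$, i.e. analytic) if its preimage under the quotient projection $X\to X/E$ is a Borel (respectively analytic) subset of $X$. Likewise, a binary relation $R\subseteq X/E\times X/E$ is called Borel (respectively $\Sigma^1_1$) if $\{(x,y)\in X\times X : ([x]_E,[y]_E)\in R\}$ is Borel (respectively analytic) in $X\times X$; equivalently, $R$ is a Borel (respectively $\Sigma^1_1$) subset of the quotient Borel space $(X\times X,E\times E)$. A Borel endomorphism of $(X,E)$ is a function $f:X/E\to X/E$ whose graph is a Borel relation; $f$ is countable-to-one if every fibre $f^{-1}(\{q\})$, $q\in X/E$, is countable. **Lemma.** Let $(X,E)$ be a quotient Borel space, let $(f_i)_{i\in I}$ be a countable family of Borel endomorphisms of $(X,E)$, and let $F$ be the equivalence relation on $X/E$ generated by it, i.e. the smallest equivalence relation on $X/E$ containing the graph of every $f_i$. Then $F$ is $\Sigma^1_1$. If moreover every $f_i$ is countable-to-one, then $F$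 is countable Borel, i.e. $F$ is a Borel relation and each of its equivalence classes in $X/E$ is countable. -/

import Mathlib

namespace QuotientBorel

/-- `E` is a countable Borel equivalence relation on the measurable space `X`: it is Borel as a
subset of `X × X`, and all its classes are countable. When `X` is a standard Borel space, the pair
`(X, E)` is then called a quotient Borel space; its underlying set is `Quotient E`. -/
structure IsCountableBorelEquiv {X : Type*} [MeasurableSpace X] (E : Setoid X) : Prop where
  measurableSet_graph : MeasurableSet {p : X × X | E p.1 p.2}
  countable_class : ∀ x : X, {y : X | E x y}.Countable

/-- Analytic (`Σ¹₁`) subsets of a standard Borel space: those which are analytic for a Polish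
topology inducing the Borel structure (which topology is used does not matter). -/
def IsAnalytic {X : Type*} [MeasurableSpace X] (A : Set X) : Prop :=
  ∃ τ : TopologicalSpace X, @BorelSpace X τ _ ∧ @PolishSpace X τ ∧ @MeasureTheory.AnalyticSet X τ A

/-- Borel subsets of `(X, E)`: the preimage under the quotient projection is Borel. -/
def IsBorelSubset {X : Type*} [MeasurableSpace X] (E : Setoid X) (A : Set (Quotient E)) : Prop :=
  MeasurableSet (Quotient.mk E ⁻¹' A)

/-- `Σ¹₁` subsets of `(X, E)`: the preimage under the quotient projection is `Σ¹₁`. -/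
def IsAnalyticSubset {X : Type*} [MeasurableSpace X] (E : Setoid X) (A : Set (Quotient E)) : Prop :=
  IsAnalytic (Quotient.mk E ⁻¹' A)

/-- A relation `R` between the points of `(X, E)` and of `(Y, F)`, seen as a subset of the
product `(X × Y, E × F)` through the identification of `X/E × Y/F` with `(X × Y)/(E × F)`. -/
def relSubset {X Y : Type*} (E : Setoid X) (F : Setoid Y) (R : Quotient E → Quotient F → Prop) :
    Set (Quotient (E.prod F)) :=
  {z | R ((Setoid.prodQuotientEquiv E F).symm z).1 ((Setoid.prodQuotientEquiv E F).symm z).2}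

/-- `R` is a Borel relation, i.e. a Borel subset of the product `(X, E) × (Y, F)`. -/
def IsBorelRel {X Y : Type*} [MeasurableSpace X] [MeasurableSpace Y] (E : Setoid X) (F : Setoid Y)
    (R : Quotient E → Quotient F → Prop) : Prop :=
  IsBorelSubset (E.prod F) (relSubset E F R)

/-- `R` is a `Σ¹₁` relation, i.e. a `Σ¹₁` subset of the product `(X, E) × (Y, F)`. -/
def IsAnalyticRel {X Y : Type*} [MeasurableSpace X] [MeasurableSpace Y] (E : Setoid X)
    (F : Setoid Y) (R : Quotient E → Quotient F → Prop) : Prop :=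
  IsAnalyticSubset (E.prod F) (relSubset E F R)

/-- A function between quotient Borel spaces is Borel if its graph is a Borel relation. -/
def IsBorelFun {X Y : Type*} [MeasurableSpace X] [MeasurableSpace Y] (E : Setoid X) (F : Setoid Y)
    (f : Quotient E → Quotient F) : Prop :=
  IsBorelRel E F fun a b => f a = b

/-- A function is countable-to-one if all its fibres are countable. -/
def CountableToOne {α β : Type*} (f : α → β) : Prop :=
  ∀ b : β, (f ⁻¹' {b}).Countable

/-- The smallest equivalence relation containing (the graph of) every function `f i`. -/
def generatedEquiv {α ι : Type*} (f : ι → α → α) : Setoid α :=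
  sInf {S : Setoid α | ∀ i a, S a (f i a)}

/-- `F` is a countable Borel equivalence relation on `(X, E)`. -/
structure IsCountableBorelEquivOn {X : Type*} [MeasurableSpace X] (E : Setoid X)
    (F : Setoid (Quotient E)) : Prop where
  borel : IsBorelRel E E fun a b => F a b
  countable_class : ∀ a : Quotient E, {b : Quotient E | F a b}.Countable

end QuotientBorel

/-! Lifted to `X`, the generated equivalence joins two points exactly when a finite chain of
`generatingRel` steps does (`generatedEquiv_mk_iff`). The chains form a Borel set, and the endpoint
map sends it onto the lifted relation, which is therefore analytic. If every `f i` is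
countable-to-one, only countably many chains start at a given point, so the endpoint map has
countable fibres on the set of chains and `measurableSet_image_of_countable_fibres` makes the image
Borel.

That Lusin–Novikov statement rests on a dichotomy for a continuous map on a Polish space: either the
domain is a countable union of Borel sets on which the map is injective, and Lusin–Souslin applies
to each piece, or repeated splitting of open boxes (`IsLargeBox.exists_split`) produces a nonempty
perfect set inside one fibre, which is then uncountable. -/

namespace QuotientBorel

open Set Filter Topology MeasureTheory TopologicalSpace Relation

/-! ### Lusin–Novikov: Borel images under countable-to-one maps -/

section CountableToOne

variable {X Z : Type*} [MeasurableSpace Z]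

/-- An analytic set on which a measurable function is injective is contained in a Borel set on
which it is injective. -/
theorem exists_measurableSet_injOn_superset {W : Type*} [MeasurableSpace W] [StandardBorelSpace W]
    [MeasurableSpace X] [StandardBorelSpace X] [StandardBorelSpace Z] {f : Z → X} (hf : Measurable f) {g : W → Z}
    (hg : Measurable g) {A : Set W} (hA : MeasurableSet A) (hinj : InjOn f (g '' A)) :
    ∃ B, MeasurableSet B ∧ InjOn f B ∧ g '' A ⊆ B := by
  let := upgradeStandardBorel Z
  have hAan : AnalyticSet (g '' A) := hA.analyticSet_image hg
  -- The first separation removes the points sharing a fibre with a different point of `g '' A`.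
  -- Inside the resulting `B`, points of `g '' A` are alone in their fibres, so a second separation
  -- can remove all points of `B` that are not.
  let T : Set (W × Z) := {p | p.1 ∈ A ∧ f (g p.1) = f p.2 ∧ g p.1 ≠ p.2}
  have hT : MeasurableSet T :=
    (measurable_fst hA).inter ((measurableSet_eq_fun (hf.comp (hg.comp measurable_fst))
      (hf.comp measurable_snd)).inter
        (measurableSet_eq_fun (hg.comp measurable_fst) measurable_snd).compl)
  have hTan : AnalyticSet (Prod.snd '' T) := hT.analyticSet_image measurable_snd
  obtain ⟨B, hAB, hTB, hB⟩ := hAan.measurablySeparable hTan (by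
    rw [Set.disjoint_left]
    rintro _ ⟨a, ha, rfl⟩ ⟨⟨w, z⟩, ⟨hw, hwz, hne⟩, rfl⟩
    exact hne (hinj ⟨w, hw, rfl⟩ ⟨a, ha, rfl⟩ hwz))
  let C : Set (Z × Z) := {p | p.1 ∈ B ∧ p.2 ∈ B ∧ f p.1 = f p.2 ∧ p.1 ≠ p.2}
  have hC : MeasurableSet C :=
    (measurable_fst hB).inter ((measurable_snd hB).inter
      ((measurableSet_eq_fun (hf.comp measurable_fst) (hf.comp measurable_snd)).inter
        (measurableSet_eq_fun measurable_fst measurable_snd).compl))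
  have hCan : AnalyticSet (Prod.snd '' C) := hC.analyticSet_image measurable_snd
  obtain ⟨D, hAD, hCD, hD⟩ := hAan.measurablySeparable hCan (by
    rw [Set.disjoint_left]
    rintro _ ⟨a, ha, rfl⟩ ⟨⟨w, z⟩, ⟨hw, -, hwz, hne⟩, hz⟩
    refine Set.disjoint_left.1 hTB ?_ hw
    exact ⟨(a, w), ⟨ha, by rw [hwz, ← hz], fun h => hne (by rw [hz]; exact h.symm)⟩, rfl⟩)
  refine ⟨B ∩ D, hB.inter hD, fun x hx y hy hxy => ?_, subset_inter hAB hAD⟩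
  by_contra hne
  exact Set.disjoint_left.1 hCD ⟨(x, y), ⟨hx.1, hy.1, hxy, hne⟩, rfl⟩ hy.2

/-- Countable unions of Borel sets on which `f` is injective. -/
def IsSigmaInjective (f : Z → X) (C : Set Z) : Prop :=
  ∃ B : ℕ → Set Z, (∀ n, MeasurableSet (B n) ∧ InjOn f (B n)) ∧ C = ⋃ n, B n

theorem IsSigmaInjective.measurableSet {f : Z → X} {C : Set Z} (h : IsSigmaInjective f C) :
    MeasurableSet C := by
  obtain ⟨B, hB, rfl⟩ := h
  exact .iUnion fun n => (hB n).1

theorem IsSigmaInjective.of_injOn {f : Z → X} {B : Set Z} (hB : MeasurableSet B)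
    (h : InjOn f B) : IsSigmaInjective f B :=
  ⟨fun _ => B, fun _ => ⟨hB, h⟩, (iUnion_const B).symm⟩

theorem IsSigmaInjective.iUnion {ι : Type*} [Countable ι] {f : Z → X} {C : ι → Set Z}
    (h : ∀ i, IsSigmaInjective f (C i)) : IsSigmaInjective f (⋃ i, C i) := by
  choose B hB hC using h
  rcases isEmpty_or_nonempty (ι × ℕ) with hι | hι
  · have : IsEmpty ι := ⟨fun i => hι.elim (i, 0)⟩
    exact ⟨fun _ => ∅, by simp, by simp⟩
  · obtain ⟨e, he⟩ := exists_surjective_nat (ι × ℕ)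
    refine ⟨fun n => B (e n).1 (e n).2, fun n => hB _ _, ?_⟩
    rw [he.iUnion_comp fun p : ι × ℕ => B p.1 p.2, iUnion_prod']
    exact iUnion_congr hC

theorem IsSigmaInjective.union {f : Z → X} {C D : Set Z} (hC : IsSigmaInjective f C)
    (hD : IsSigmaInjective f D) : IsSigmaInjective f (C ∪ D) := by
  rw [union_eq_iUnion]
  exact .iUnion (by rintro (_ | _) <;> assumption)

theorem IsSigmaInjective.measurableSet_image [MeasurableSpace X] [StandardBorelSpace X] [StandardBorelSpace Z]
    {f : Z → X} (hf : Measurable f) (h : IsSigmaInjective f univ) {A : Set Z}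
    (hA : MeasurableSet A) : MeasurableSet (f '' A) := by
  obtain ⟨B, hB, hU⟩ := h
  rw [← inter_univ A, hU, inter_iUnion, image_iUnion]
  exact .iUnion fun n => (hA.inter (hB n).1).image_of_measurable_injOn hf
    ((hB n).2.mono inter_subset_right)

/-- The box `U 0 × ⋯ × U n` contains a tuple lying in a single fibre of `f` and avoiding any
prescribed countable union of Borel sets on which `f` is injective. -/
def IsLargeBox (f : Z → X) (n : ℕ) (U : ℕ → Set Z) : Prop :=
  ∀ C, IsSigmaInjective f C →
    ∃ a : ℕ → Z, (∀ j ≤ n, a j ∈ U j ∧ a j ∉ C) ∧ ∀ j ≤ n, f (a j) = f (a 0)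

theorem isLargeBox_zero {f : Z → X} (h : ¬ IsSigmaInjective f univ) :
    IsLargeBox f 0 fun _ => univ := by
  intro C hC
  obtain ⟨z, hz⟩ : ∃ z, z ∉ C := by
    by_contra! hall
    exact h (eq_univ_of_forall hall ▸ hC)
  exact ⟨fun _ => z, by simp [hz], by simp⟩

/-- If no split into basic open sets worked, the countably many exceptional sets would have a
sigma-injective union. Among the tuples of the box avoiding it, two have distinct `i`-th coordinates
in one fibre; otherwise those coordinates would lie in one more avoidable Borel set. Appending one
such coordinate to the other tuple and shrinking neighbourhoods gives a contradiction. -/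
theorem IsLargeBox.exists_split [MetricSpace Z] [SecondCountableTopology Z] [BorelSpace Z]
    [StandardBorelSpace Z]
    [MeasurableSpace X] [StandardBorelSpace X] {f : Z → X} (hf : Measurable f) {n : ℕ}
    {U : ℕ → Set Z} (hU : ∀ j, IsOpen (U j)) (hL : IsLargeBox f n U) {i : ℕ} (hi : i ≤ n)
    {ε : ℝ} (hε : 0 < ε) :
    ∃ V : ℕ → Set Z, (∀ j, IsOpen (V j)) ∧ IsLargeBox f (n + 1) V ∧
      (∀ j ≤ n, closure (V j) ⊆ U j) ∧ V (n + 1) ⊆ U i ∧ Disjoint (V i) (V (n + 1)) ∧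
      ∀ j ≤ n + 1, ∃ c, V j ⊆ Metric.closedBall c ε := by
  let V (v : Fin (n + 2) → countableBasis Z) (j : ℕ) : Set Z :=
    if h : j < n + 2 then v ⟨j, h⟩ else ∅
  have hVo (v) (j) : IsOpen (V v j) := by
    unfold V
    split_ifs with h
    · exact (isBasis_countableBasis Z).isOpen (v _).2
    · exact isOpen_empty
  by_contra! hno
  have hsmall : ∀ v, ∃ C, IsSigmaInjective f C ∧ ((∀ j ≤ n, closure (V v j) ⊆ U j) →
      V v (n + 1) ⊆ U i → Disjoint (V v i) (V v (n + 1)) →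
      (∀ j ≤ n + 1, ∃ c, V v j ⊆ Metric.closedBall c ε) →
      ∀ a : ℕ → Z, (∀ j ≤ n + 1, a j ∈ V v j ∧ a j ∉ C) → ∃ j ≤ n + 1, f (a j) ≠ f (a 0)) := by
    intro v
    -- By `hno` a large box fails some geometric requirement, so its exceptional set may be empty.
    by_cases hv : IsLargeBox f (n + 1) (V v)
    · refine ⟨∅, .of_injOn .empty (injOn_empty f), fun h1 h2 h3 h4 => ?_⟩
      obtain ⟨j, hj, h⟩ := hno (V v) (hVo v) hv h1 h2 h3
      obtain ⟨c, hc⟩ := h4 j hj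
      exact absurd hc (h c)
    · unfold IsLargeBox at hv
      push Not at hv
      obtain ⟨C, hC, h⟩ := hv
      exact ⟨C, hC, fun _ _ _ _ => h⟩
  choose C hC hCV using hsmall
  have hCU := IsSigmaInjective.iUnion hC
  let A : Set (ℕ → Z) :=
    {a | (∀ j ≤ n, a j ∈ U j ∧ a j ∉ ⋃ v, C v) ∧ ∀ j ≤ n, f (a j) = f (a 0)}
  have hA : MeasurableSet A := by
    have : A = (⋂ j ∈ Iic n, (fun a : ℕ → Z => a j) ⁻¹' (U j \ ⋃ v, C v)) ∩
        ⋂ j ∈ Iic n, {a : ℕ → Z | f (a j) = f (a 0)} := by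
      ext a
      simp [A]
    rw [this]
    exact (MeasurableSet.biInter (to_countable _) fun j _ =>
      measurable_pi_apply j ((hU j).measurableSet.diff hCU.measurableSet)).inter
        (.biInter (to_countable _) fun j _ => measurableSet_eq_fun
          (hf.comp (measurable_pi_apply j)) (hf.comp (measurable_pi_apply 0)))
  obtain ⟨a, ha, b, hb, hfab, hab⟩ : ∃ a ∈ A, ∃ b ∈ A, f (a i) = f (b i) ∧ a i ≠ b i := by
    by_contra! hinj
    obtain ⟨B, hB, hBinj, hAB⟩ := exists_measurableSet_injOn_superset hf
      (measurable_pi_apply (X := fun _ : ℕ => Z) i) hA (by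
        rintro _ ⟨a, ha, rfl⟩ _ ⟨b, hb, rfl⟩ h
        exact hinj a ha b hb h)
    obtain ⟨a, ha, haf⟩ := hL _ (hCU.union (.of_injOn hB hBinj))
    have haA : a ∈ A := ⟨fun j hj => ⟨(ha j hj).1, fun h => (ha j hj).2 (.inl h)⟩, haf⟩
    exact (ha i hi).2 (.inr (hAB ⟨a, haA, rfl⟩))
  obtain ⟨G, H, hG, hH, haG, hbH, hGH⟩ := t2_separation hab
  let c : ℕ → Z := fun j => if j = n + 1 then b i else a j
  let O : ℕ → Set Z := fun j => if j = n + 1 then U i ∩ H else if j = i then U i ∩ G else U j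
  have hO (j) : IsOpen (O j) := by
    unfold O
    split_ifs
    exacts [(hU i).inter hH, (hU i).inter hG, hU j]
  have hcO : ∀ j < n + 2, c j ∈ O j := by
    intro j hj
    unfold c O
    split_ifs with h1 h2
    · exact ⟨(hb.1 i hi).1, hbH⟩
    · subst h2
      exact ⟨(ha.1 _ hi).1, haG⟩
    · exact (ha.1 j (by omega)).1
  have hW : ∀ j : Fin (n + 2), ∃ W : countableBasis Z, c j ∈ (W : Set Z) ∧
      closure (W : Set Z) ⊆ O j ∩ Metric.ball (c j) ε := by
    intro j
    obtain ⟨W, hWb, hcW, hWO⟩ := (isBasis_countableBasis Z).exists_closure_subset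
      (((hO j).inter Metric.isOpen_ball).mem_nhds ⟨hcO j j.2, Metric.mem_ball_self hε⟩)
    exact ⟨⟨W, hWb⟩, hcW, hWO⟩
  choose W hcW hWO using hW
  have hVW (j) (hj : j < n + 2) : V W j = W ⟨j, hj⟩ := dif_pos hj
  have hVO (j) (hj : j < n + 2) : closure (V W j) ⊆ O j ∩ Metric.ball (c j) ε := by
    rw [hVW j hj]
    exact hWO ⟨j, hj⟩
  have hOl : O (n + 1) = U i ∩ H := if_pos rfl
  have hOi : O i = U i ∩ G := by
    unfold O
    rw [if_neg (by omega), if_pos rfl]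
  have hcl : c (n + 1) = b i := if_pos rfl
  have hcj (j) (hj : j ≤ n) : c j = a j := if_neg (by omega)
  have hVl : V W (n + 1) ⊆ U i ∩ H :=
    subset_closure.trans ((hVO _ (by omega)).trans (inter_subset_left.trans hOl.subset))
  have hVi : V W i ⊆ U i ∩ G :=
    subset_closure.trans ((hVO _ (by omega)).trans (inter_subset_left.trans hOi.subset))
  obtain ⟨j, hj, hne⟩ := hCV W (fun j hj => by
      refine (hVO j (by omega)).trans (inter_subset_left.trans ?_)
      by_cases h : j = i
      · subst h
        exact hOi.subset.trans inter_subset_left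
      · unfold O
        rw [if_neg (by omega), if_neg h])
    (hVl.trans inter_subset_left)
    (hGH.symm.mono (hVl.trans inter_subset_right) (hVi.trans inter_subset_right)).symm
    (fun j hj => ⟨c j, subset_closure.trans ((hVO j (by omega)).trans
      (inter_subset_right.trans Metric.ball_subset_closedBall))⟩)
    c (fun j hj => by
      refine ⟨by rw [hVW j (by omega)]; exact hcW ⟨j, _⟩, fun hc => ?_⟩
      have hc := mem_iUnion_of_mem (s := C) W hc
      rcases Nat.lt_or_eq_of_le hj with h | rfl
      · rw [hcj j (by omega)] at hc
        exact (ha.1 j (by omega)).2 hc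
      · rw [hcl] at hc
        exact (hb.1 i hi).2 hc)
  refine hne ?_
  rw [hcj 0 (by omega)]
  rcases Nat.lt_or_eq_of_le hj with h | rfl
  · rw [hcj j (by omega), ha.2 j (by omega)]
  · rw [hcl, ← hfab, ha.2 i hi]

/-- A countable-to-one continuous function on a Polish space is injective on each piece of a
countable Borel cover. -/
theorem isSigmaInjective_univ_of_continuous [MetricSpace Z] [CompleteSpace Z]
    [SecondCountableTopology Z] [BorelSpace Z] [TopologicalSpace X] [T2Space X]
    [MeasurableSpace X] [StandardBorelSpace X] {f : Z → X} (hf : Measurable f)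
    (hfc : Continuous f) (hcount : ∀ x, (f ⁻¹' {x}).Countable) : IsSigmaInjective f univ := by
  by_contra hbig
  let S (n : ℕ) := {U : ℕ → Set Z // (∀ j, IsOpen (U j)) ∧ IsLargeBox f n U}
  -- Stage `n` splits coordinate `n.unpair.1`, so every coordinate is split infinitely often.
  have hstep (n : ℕ) (U : S n) : ∃ V : S (n + 1), (∀ j ≤ n, closure (V.1 j) ⊆ U.1 j) ∧
      V.1 (n + 1) ⊆ U.1 n.unpair.1 ∧ Disjoint (V.1 n.unpair.1) (V.1 (n + 1)) ∧
      ∀ j ≤ n + 1, ∃ c, V.1 j ⊆ Metric.closedBall c (1 / ((n : ℝ) + 1)) := by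
    obtain ⟨V, h1, h2, h3⟩ := U.2.2.exists_split hf U.2.1 n.unpair_left_le
      (Nat.one_div_pos_of_nat (α := ℝ) (n := n))
    exact ⟨⟨V, h1, h2⟩, h3⟩
  choose next hnext using hstep
  let U (n : ℕ) : S n :=
    Nat.rec ⟨fun _ => univ, fun _ => isOpen_univ, isLargeBox_zero hbig⟩ next n
  have hU (n : ℕ) := hnext n (U n)
  change ∀ n : ℕ, (∀ j ≤ n, closure ((U (n + 1)).1 j) ⊆ (U n).1 j) ∧
    (U (n + 1)).1 (n + 1) ⊆ (U n).1 n.unpair.1 ∧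
    Disjoint ((U (n + 1)).1 n.unpair.1) ((U (n + 1)).1 (n + 1)) ∧
    ∀ j ≤ n + 1, ∃ c, (U (n + 1)).1 j ⊆ Metric.closedBall c (1 / ((n : ℝ) + 1)) at hU
  have hanti {j m n : ℕ} (hj : j ≤ m) (hmn : m ≤ n) : (U n).1 j ⊆ (U m).1 j := by
    induction n, hmn using Nat.le_induction with
    | base => rfl
    | succ n hmn ih => exact subset_closure.trans (((hU n).1 j (hj.trans hmn)).trans ih)
  have hdist {j n : ℕ} (hj : j ≤ n + 1) {x y : Z} (hx : x ∈ (U (n + 1)).1 j)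
      (hy : y ∈ (U (n + 1)).1 j) : dist x y ≤ 2 * (1 / ((n : ℝ) + 1)) := by
    obtain ⟨c, hc⟩ := (hU n).2.2.2 j hj
    have h1 := Metric.mem_closedBall.1 (hc hx)
    have h2 := Metric.mem_closedBall'.1 (hc hy)
    linarith [dist_triangle x c y]
  have hlim : Tendsto (fun n : ℕ => 2 * (1 / ((n : ℝ) + 1))) atTop (𝓝 0) := by
    simpa using (tendsto_one_div_add_atTop_nhds_zero_nat (𝕜 := ℝ)).const_mul 2
  have hpts (n : ℕ) := (U n).2.2 ∅ (.of_injOn .empty (injOn_empty f))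
  choose a ha haf using hpts
  have hconv (j : ℕ) : ∃ z, Tendsto (fun n => a n j) atTop (𝓝 z) := by
    refine cauchySeq_tendsto_of_complete (Metric.cauchySeq_iff'.2 fun ε hε => ?_)
    obtain ⟨N, hN, hjN⟩ := ((hlim.eventually_lt_const hε).and (eventually_ge_atTop j)).exists
    exact ⟨N + 1, fun n hn => (hdist (by omega)
      (hanti (by omega) hn (ha n j (by omega)).1) (ha (N + 1) j (by omega)).1).trans_lt hN⟩
  choose z hz using hconv
  have hzU {j n : ℕ} (hj : j ≤ n) : z j ∈ (U n).1 j := by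
    refine (hU n).1 j hj (mem_closure_of_tendsto (hz j) ?_)
    filter_upwards [eventually_ge_atTop (n + 1)] with m hm
    exact hanti (by omega) hm (ha m j (by omega)).1
  have hfz (j : ℕ) : f (z j) = f (z 0) := by
    refine tendsto_nhds_unique_of_eventuallyEq ((hfc.tendsto _).comp (hz j))
      ((hfc.tendsto _).comp (hz 0)) ?_
    filter_upwards [eventually_ge_atTop j] with n hn using haf n j hn
  have hpre : Preperfect (range z) := by
    rw [preperfect_iff_nhds]
    rintro _ ⟨j, rfl⟩ O hO
    obtain ⟨ε, hε, hεO⟩ := Metric.mem_nhds_iff.1 hO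
    obtain ⟨N, hN⟩ := eventually_atTop.1 (hlim.eventually_lt_const hε)
    obtain ⟨m, hm, hmj⟩ : ∃ m, j + N + 1 ≤ m ∧ (Nat.unpair m).1 = j :=
      ⟨Nat.pair j (j + N + 1), Nat.right_le_pair _ _, by simp⟩
    obtain ⟨m, rfl⟩ : ∃ k, m = k + 1 := ⟨m - 1, by omega⟩
    obtain ⟨-, h2, h3, -⟩ := hU (m + 1)
    rw [hmj] at h2 h3
    have hl : z (m + 1 + 1) ∈ (U (m + 1 + 1)).1 (m + 1 + 1) :=
      hzU (j := m + 1 + 1) (n := m + 1 + 1) le_rfl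
    have hj (n : ℕ) (hn : j ≤ n) : z j ∈ (U n).1 j := hzU hn
    refine ⟨z (m + 1 + 1), ⟨hεO ?_, mem_range_self _⟩, fun h => ?_⟩
    · exact (hdist (j := j) (n := m) (by omega) (h2 hl) (hj (m + 1) (by omega))).trans_lt
        (hN m (by omega))
    · exact Set.disjoint_left.1 h3 (hj (m + 1 + 1) (by omega)) (h ▸ hl)
  -- By continuity the fibre is closed, so it contains the closure of `range z` and hence an
  -- injective image of Cantor space.
  obtain ⟨g, hg, -, hginj⟩ := hpre.perfect_closure.exists_nat_bool_injection
    (range_nonempty z).closure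
  have hsub : closure (range z) ⊆ f ⁻¹' {f (z 0)} :=
    closure_minimal (by rintro _ ⟨j, rfl⟩; exact hfz j) (isClosed_singleton.preimage hfc)
  have hc : (range g).Countable := (hcount _).mono (hg.trans hsub)
  have := hc.to_subtype
  have hle := Cardinal.mk_le_aleph0_iff.2 (Equiv.ofInjective g hginj).injective.countable
  exact hle.not_gt (by simpa using Cardinal.cantor Cardinal.aleph0)

/-- **Lusin–Novikov**, for images: if a measurable function between standard Borel spaces has
countable fibres on a Borel set, then the image of this set is Borel. -/
theorem measurableSet_image_of_countable_fibres [StandardBorelSpace Z] [MeasurableSpace X]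
    [StandardBorelSpace X] {f : Z → X} (hf : Measurable f) {A : Set Z} (hA : MeasurableSet A)
    (hcount : ∀ x, (A ∩ f ⁻¹' {x}).Countable) : MeasurableSet (f '' A) := by
  have hsb := hA.standardBorel
  have hg : Measurable fun z : A => f z := hf.comp measurable_subtype_coe
  let := upgradeStandardBorel X
  have hinj : IsSigmaInjective (fun z : A => f z) univ := by
    obtain ⟨t, ht, hp⟩ := hsb.polish
    -- A finer Polish topology makes the map continuous without changing the Borel sets.
    obtain ⟨t', htt, hc, hp'⟩ := hg.exists_continuous
    have : @BorelSpace A t' _ := by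
      constructor
      rw [ht.measurable_eq]
      exact (borel_eq_borel_of_le hp' hp htt).symm
    let := @upgradeIsCompletelyMetrizable A t' _
    refine isSigmaInjective_univ_of_continuous hg hc fun x => ?_
    exact ((hcount x).preimage Subtype.val_injective).mono fun z hz => (⟨z.2, hz⟩ : _ ∧ _)
  have := hinj.measurableSet_image hg .univ
  rwa [image_univ, show range (fun z : A => f z) = f '' A from (image_eq_range f A).symm] at this

end CountableToOne

/-! ### Finite chains and reflexive transitive closures -/

section Chains

variable {X : Type*}

/-- The finite chains for `T`, as pairs of a length `n` and a sequence that is constant from `n`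
on. -/
def chains (T : X → X → Prop) : Set (ℕ × (ℕ → X)) :=
  {p | (∀ k < p.1, T (p.2 k) (p.2 (k + 1))) ∧ ∀ k ≥ p.1, p.2 k = p.2 p.1}

theorem reflTransGen_iff_chains {T : X → X → Prop} {x y : X} :
    ReflTransGen T x y ↔ ∃ p ∈ chains T, p.2 0 = x ∧ p.2 p.1 = y := by
  constructor
  · intro h
    induction h using ReflTransGen.head_induction_on with
    | refl => exact ⟨(0, fun _ => y), by simp [chains]⟩
    | @head a c hac _ ih =>
      obtain ⟨⟨n, s⟩, ⟨h1, h2⟩, rfl, rfl⟩ := ih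
      refine ⟨(n + 1, fun k => Nat.casesOn k a s), ⟨?_, ?_⟩, rfl, rfl⟩
      · rintro (_ | k) hk
        · exact hac
        · exact h1 k (by simpa using hk)
      · rintro (_ | k) hk
        · simp at hk
        · exact h2 k (by simpa using hk)
  · rintro ⟨⟨n, s⟩, ⟨h1, -⟩, rfl, rfl⟩
    have : ∀ k ≤ n, ReflTransGen T (s 0) (s k) := by
      intro k hk
      induction k with
      | zero => exact .refl
      | succ k ih => exact (ih (by omega)).tail (h1 k (by simpa using hk))
    exact this n le_rfl

/-- The constant tail matters here: with free values after the last step, one chain would have too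
many representatives. -/
theorem countable_chains {T : X → X → Prop} (hT : ∀ x, {y | T x y}.Countable) (x : X) :
    {p ∈ chains T | p.2 0 = x}.Countable := by
  have key (n : ℕ) : ∀ x, {s : ℕ → X | (n, s) ∈ chains T ∧ s 0 = x}.Countable := by
    induction n with
    | zero =>
      refine fun x => (countable_singleton fun _ => x).mono ?_
      rintro s ⟨⟨-, h⟩, rfl⟩
      exact funext fun k => h k (Nat.zero_le k)
    | succ n ih =>
      intro x
      refine (((hT x).biUnion fun y _ => ih y).image fun s k => Nat.casesOn k x s).mono ?_
      rintro s ⟨⟨h1, h2⟩, rfl⟩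
      refine ⟨fun k => s (k + 1), mem_biUnion (h1 0 (Nat.succ_pos n))
        ⟨⟨fun k hk => h1 (k + 1) (Nat.succ_lt_succ hk),
          fun k hk => h2 (k + 1) (Nat.succ_le_succ hk)⟩, rfl⟩, ?_⟩
      funext k
      cases k <;> rfl
  refine (countable_iUnion fun n => (key n x).image (Prod.mk n)).mono ?_
  rintro ⟨n, s⟩ h
  exact mem_iUnion.2 ⟨n, s, h, rfl⟩

theorem setOf_reflTransGen_eq_image (T : X → X → Prop) :
    {q : X × X | ReflTransGen T q.1 q.2} = (fun p => (p.2 0, p.2 p.1)) '' chains T := by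
  ext ⟨x, y⟩
  simp [reflTransGen_iff_chains (T := T)]

theorem countable_setOf_reflTransGen {T : X → X → Prop} (hT : ∀ x, {y | T x y}.Countable) (x : X) :
    {y | ReflTransGen T x y}.Countable := by
  refine ((countable_chains hT x).image fun p => p.2 p.1).mono fun y hy => ?_
  obtain ⟨p, hp, h0, h1⟩ := reflTransGen_iff_chains.1 hy
  exact ⟨p, ⟨hp, h0⟩, h1⟩

variable [MeasurableSpace X]

theorem measurable_eval_pair : Measurable fun p : ℕ × (ℕ → X) => (p.2 0, p.2 p.1) :=
  measurable_from_prod_countable_right fun n =>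
    (measurable_pi_apply 0).prodMk (measurable_pi_apply n)

variable [StandardBorelSpace X]

theorem measurableSet_chains {T : X → X → Prop} (hT : MeasurableSet {q : X × X | T q.1 q.2}) :
    MeasurableSet (chains T) := by
  have : chains T = ⋃ n : ℕ, Prod.fst ⁻¹' {n} ∩ Prod.snd ⁻¹'
      ((⋂ k ∈ Iio n, {s : ℕ → X | T (s k) (s (k + 1))}) ∩
        ⋂ k ∈ Ici n, {s : ℕ → X | s k = s n}) := by
    ext ⟨n, s⟩
    simp [chains]
  rw [this]
  refine .iUnion fun n => (measurable_fst (measurableSet_singleton n)).inter (measurable_snd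
    (.inter (.biInter (to_countable _) fun k _ => ?_) (.biInter (to_countable _) fun k _ =>
      measurableSet_eq_fun (measurable_pi_apply k) (measurable_pi_apply n))))
  have hk : Measurable fun s : ℕ → X => (s k, s (k + 1)) :=
    (measurable_pi_apply k).prodMk (measurable_pi_apply (k + 1))
  exact hk hT

theorem isAnalytic_setOf_reflTransGen {T : X → X → Prop}
    (hT : MeasurableSet {q : X × X | T q.1 q.2}) :
    IsAnalytic {q : X × X | ReflTransGen T q.1 q.2} := by
  let := upgradeStandardBorel X
  refine ⟨inferInstance, inferInstance, inferInstance, ?_⟩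
  rw [setOf_reflTransGen_eq_image]
  exact (measurableSet_chains hT).analyticSet_image measurable_eval_pair

theorem measurableSet_setOf_reflTransGen {T : X → X → Prop}
    (hT : MeasurableSet {q : X × X | T q.1 q.2}) (hc : ∀ x, {y | T x y}.Countable) :
    MeasurableSet {q : X × X | ReflTransGen T q.1 q.2} := by
  rw [setOf_reflTransGen_eq_image]
  refine measurableSet_image_of_countable_fibres measurable_eval_pair (measurableSet_chains hT) ?_
  rintro ⟨x, y⟩
  exact (countable_chains hc x).mono fun p hp =>
    (⟨hp.1, congrArg Prod.fst hp.2⟩ : _ ∧ _)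

end Chains

/-! ### Lifting the generated equivalence to `X` -/

/-- The relation on `X` of being `E`-equivalent or related, up to order, by some `f i`. -/
def generatingRel {X ι : Type*} (E : Setoid X) (f : ι → Quotient E → Quotient E) (x y : X) : Prop :=
  E x y ∨ ∃ i, f i ⟦x⟧ = ⟦y⟧ ∨ f i ⟦y⟧ = ⟦x⟧

section Generated

variable {X ι : Type*} {E : Setoid X} {f : ι → Quotient E → Quotient E}

theorem generatingRel_symm {x y : X} (h : generatingRel E f x y) : generatingRel E f y x :=
  h.imp E.symm fun ⟨i, hi⟩ => ⟨i, hi.symm⟩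

theorem generatedEquiv_apply {α : Type*} (f : ι → α → α) (i : ι) (a : α) :
    generatedEquiv f a (f i a) := fun _ hS => hS i a

/-- Since `E`-steps are allowed, chain-connectedness is `E`-invariant and descends to an equivalence
relation on the quotient containing every graph; minimality gives the forward direction. -/
theorem generatedEquiv_mk_iff {x y : X} :
    generatedEquiv f ⟦x⟧ ⟦y⟧ ↔ ReflTransGen (generatingRel E f) x y := by
  constructor
  · intro h
    have hE {x x' y y' : X} (hx : E x x') (hy : E y y')
        (h : ReflTransGen (generatingRel E f) x y) : ReflTransGen (generatingRel E f) x' y' :=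
      (h.tail (.inl hy)).head (.inl (E.symm hx))
    let S : Setoid (Quotient E) :=
      { r := Quotient.lift₂ (ReflTransGen (generatingRel E f)) fun _ _ _ _ hx hy =>
          propext ⟨hE hx hy, hE (E.symm hx) (E.symm hy)⟩
        iseqv :=
          { refl := fun a => Quotient.inductionOn a fun _ => .refl
            symm := fun {a b} => Quotient.inductionOn₂ a b fun x y h =>
              have : Std.Symm (generatingRel E f) := ⟨fun _ _ => generatingRel_symm⟩
              (ReflTransGen.stdSymm (r := generatingRel E f)).symm _ _ h
            trans := fun {a b c} => Quotient.inductionOn₃ a b c fun _ _ _ h h' => h.trans h' } }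
    refine h S fun i a => ?_
    induction a using Quotient.inductionOn with | _ x
    obtain ⟨y, hy⟩ := Quotient.exists_rep (f i ⟦x⟧)
    rw [← hy]
    exact ReflTransGen.single (.inr ⟨i, .inl hy.symm⟩)
  · intro h
    induction h with
    | refl => exact (generatedEquiv f).refl _
    | @tail y z _ hyz ih =>
      refine (generatedEquiv f).trans ih ?_
      rcases hyz with h | ⟨i, h | h⟩
      · rw [Quotient.sound h]
      · rw [← h]
        exact generatedEquiv_apply f i _
      · rw [← h]
        exact (generatedEquiv f).symm (generatedEquiv_apply f i _)

theorem measurableSet_generatingRel [MeasurableSpace X] [Countable ι]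
    (hE : IsCountableBorelEquiv E) (hf : ∀ i, IsBorelFun E E (f i)) :
    MeasurableSet {q : X × X | generatingRel E f q.1 q.2} := by
  have hgraph (i) : MeasurableSet {q : X × X | f i ⟦q.1⟧ = ⟦q.2⟧} := hf i
  have : {q : X × X | generatingRel E f q.1 q.2} = {q | E q.1 q.2} ∪
      ⋃ i, {q | f i ⟦q.1⟧ = ⟦q.2⟧} ∪ Prod.swap ⁻¹' {q | f i ⟦q.1⟧ = ⟦q.2⟧} := by
    ext ⟨x, y⟩
    simp [generatingRel]
  rw [this]
  exact hE.measurableSet_graph.union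
    (.iUnion fun i => (hgraph i).union (measurable_swap (hgraph i)))

/-- A forward step reaches a single class, a backward step a countable fibre of classes, and classes
are countable. -/
theorem countable_setOf_generatingRel [MeasurableSpace X] [Countable ι]
    (hE : IsCountableBorelEquiv E) (hf : ∀ i, CountableToOne (f i)) (x : X) :
    {y | generatingRel E f x y}.Countable := by
  have hpre {A : Set (Quotient E)} (hA : A.Countable) : (Quotient.mk E ⁻¹' A).Countable := by
    rw [← biUnion_preimage_singleton]
    refine hA.biUnion fun a _ => ?_
    induction a using Quotient.inductionOn with | _ y
    exact (hE.countable_class y).mono fun z hz => E.symm (Quotient.exact hz)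
  refine ((hE.countable_class x).union (countable_iUnion fun i =>
    (hpre (countable_singleton (f i ⟦x⟧))).union (hpre (hf i ⟦x⟧)))).mono ?_
  rintro y (h | ⟨i, h | h⟩)
  · exact .inl h
  · exact .inr (mem_iUnion.2 ⟨i, .inl h.symm⟩)
  · exact .inr (mem_iUnion.2 ⟨i, .inr h⟩)

end Generated

end QuotientBorel

theorem mainTheorem10 {X : Type*} [MeasurableSpace X] [StandardBorelSpace X]
    (E : Setoid X) (hE : QuotientBorel.IsCountableBorelEquiv E)
    {ι : Type*} [Countable ι] (f : ι → Quotient E → Quotient E)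
    (hf : ∀ i, QuotientBorel.IsBorelFun E E (f i)) :
    QuotientBorel.IsAnalyticRel E E (fun a b => QuotientBorel.generatedEquiv f a b) ∧
      ((∀ i, QuotientBorel.CountableToOne (f i)) →
        QuotientBorel.IsCountableBorelEquivOn E (QuotientBorel.generatedEquiv f)) := by
  open QuotientBorel in
  have hT := measurableSet_generatingRel hE hf
  have hpre : Quotient.mk (E.prod E) ⁻¹' relSubset E E (fun a b => generatedEquiv f a b) =
      {q : X × X | Relation.ReflTransGen (generatingRel E f) q.1 q.2} :=
    Set.ext fun q => generatedEquiv_mk_iff (x := q.1) (y := q.2)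
  refine ⟨?_, fun hc => ⟨?_, fun a => ?_⟩⟩
  · unfold IsAnalyticRel IsAnalyticSubset
    rw [hpre]
    exact isAnalytic_setOf_reflTransGen hT
  · unfold IsBorelRel IsBorelSubset
    rw [hpre]
    exact measurableSet_setOf_reflTransGen hT (countable_setOf_generatingRel hE hc)
  · induction a using Quotient.inductionOn with | _ x
    refine ((countable_setOf_reflTransGen (countable_setOf_generatingRel hE hc) x).image
      (Quotient.mk E)).mono fun b hb => ?_
    induction b using Quotient.inductionOn with | _ y
    exact ⟨y, generatedEquiv_mk_iff.1 hb, rfl⟩
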